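/- Let $p,q\ge 1$ be coprime integers and consider the square lattice on the cylinder $\mathbb Z^2/\mathbb Z(p,q)$, in which every site has its four lattice neighbours (counted with multiplicity). Let $\Sigma$ be the half-infinite cylinder, i.e. the image of $[0,p]\times[0,\infty)\cap\mathbb Z^2$, and let $\partial\Sigma$ be (the image of) any subset of $[0,p]\times[0,q]\cap\mathbb Z^2$; for example $\{(i,j): iq>jp\}$ models the half-plane $\{iq\le jp\}$. The sites of $\Sigma\setminus\partial\Sigma$ are internal, all other sites of the cylinder are sinks. In a toppling at an internal site $v$, $v$ loses four grains and each neighbour of $v$ receives one; it is legal if $v$ holds at least $4$ grains. A state is stable if all internal sites hold at most $3$ grains; a territory of a stable state is a connected component, with at least two vertices, of the full subgraph on the internal sites holding exactly $3$ grains. Sending a wave from a site $v$ in a territory means: add a grain at $v$, topple $v$, then relax by (possibly infinitely many, but locally finitely many) legal topplings at internal sites other than $v$ until all of these sites are stable, and finally remove a grain from $v$. Start from the state with $3$ grains at every internal site, and send $n$ waves from a site $(i_0,N)$, $0\le i_0\le p$. Let $h^{(n)}$ be the total number of topplings at each site and $\phi^{(n)}$ the state obtained. Then there is a constant $C=C_{p,q}$,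 depending only on $p,q$, such that for every $\partial\Sigma$ there is an integer $k=k_{p,q,\partial\Sigma}$ with the following property. For every $n\ge 0$ and all sufficiently large $N$ (depending on $n$), the $n$ waves can be sent, and the defect set $$Def=\{(i,j)\in[0,p]\times[0,\infty)\cap\mathbb Z^2 : h^{(n)}(i,j)\neq\min(pj-qi+k,\,n)\}$$ satisfies $|Def|<C$. Moreover, there is an integer $a$ (depending on $n$) and a decomposition $Def=B\cup E$ with $B\subset[0,p]\times[0,C]$ (boundary artifacts) and $E\subset[0,p]\times[a,a+C]\cap\{|pj-qi+k-n|\le C\}$, a band of bounded width along the line $pj-qi+k=n$ of direction $(p,q)$. All coloured sites (internal sites with $\phi^{(n)}<3$) lie in these two regions $[0,p]\times[0,C]$ and $[0,p]\times[a,a+C]\cap\{|pj-qi+k-n|\le C\}$, those in the second one forming the tracery of the discrete tropical edge. -/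

import Mathlib

namespace WaveCylinder

/-- The infinite periodic cylinder `ℤ² / ℤ(p,q)`. -/
abbrev Cyl (p q : ℕ) : Type :=
  (ℤ × ℤ) ⧸ AddSubgroup.zmultiples (((p : ℤ), (q : ℤ)) : ℤ × ℤ)

variable {p q : ℕ}

/-- The site of the cylinder represented by a lattice point. -/
def site (p q : ℕ) (x : ℤ × ℤ) : Cyl p q := QuotientAddGroup.mk x

/-- The horizontal unit step. -/
def stepX (p q : ℕ) : Cyl p q := site p q (1, 0)

/-- The vertical unit step. -/
def stepY (p q : ℕ) : Cyl p q := site p q (0, 1)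

/-- The nearest-neighbour graph of the cylinder. -/
def cylGraph (p q : ℕ) : SimpleGraph (Cyl p q) :=
  SimpleGraph.fromRel fun v w => w = v + stepX p q ∨ w = v + stepY p q

/-- The lattice points of the half-infinite strip `[0,p] × [0,∞)`. -/
def strip (p : ℕ) : Set (ℤ × ℤ) := {x | 0 ≤ x.1 ∧ x.1 ≤ p ∧ 0 ≤ x.2}

/-- The internal sites of the half-infinite cylinder `Σ` (the image of the strip) with boundary
represented by `S`. All other sites of `ℤ² / ℤ(p,q)` are sinks. -/
def internal (p q : ℕ) (S : Set (ℤ × ℤ)) : Set (Cyl p q) :=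
  (site p q '' strip p) \ (site p q '' S)

/-- Distributions of sand. The values at the sinks only record the lost sand. -/
abbrev State (p q : ℕ) : Type := Cyl p q → ℤ

open Classical in
/-- One grain of sand at `v`. -/
noncomputable def grain (v : Cyl p q) : State p q := fun w => if w = v then 1 else 0

/-- The toppling at `v`: four grains leave `v`, one along each of the four lattice steps (two of
these steps may lead to the same site, which happens for `p = q = 1`). -/
noncomputable def topple (v : Cyl p q) (φ : State p q) : State p q :=
  φ - 4 • grain v + grain (v + stepX p q) + grain (v - stepX p q)
    + grain (v + stepY p q) + grain (v - stepY p q)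

/-- The states along a sequence of topplings; `none` stands for an idle step, so that finite
sequences are covered. -/
noncomputable def run (φ : State p q) (x : ℕ → Option (Cyl p q)) : ℕ → State p q
  | 0 => φ
  | i + 1 => match x i with
    | none => run φ x i
    | some w => topple w (run φ x i)

/-- `φ` is stable on the set `A`. -/
def StableOn (A : Set (Cyl p q)) (φ : State p q) : Prop := ∀ w ∈ A, φ w < 4

/-- `φ` has a locally finite stabilizing relaxation, by legal topplings at vertices of `A` only,
with toppling function `u` and resulting state `ψ`. -/
def Relaxes (A : Set (Cyl p q)) (φ : State p q) (u : Cyl p q → ℕ) (ψ : State p q) : Prop :=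
  ∃ x : ℕ → Option (Cyl p q),
    (∀ i w, x i = some w → w ∈ A ∧ 4 ≤ run φ x i w) ∧
    (∀ w, {i | x i = some w}.Finite ∧ u w = {i | x i = some w}.ncard) ∧
    (∀ w, ∀ᶠ i in Filter.atTop, run φ x i w = ψ w) ∧
    StableOn A ψ

/-- `v` belongs to a territory of `φ`: a connected component, with at least two vertices, of the
full subgraph on the internal sites that carry three grains. -/
def InTerritory (D : Set (Cyl p q)) (φ : State p q) (v : Cyl p q) : Prop :=
  ∃ c : ((cylGraph p q).induce {w | w ∈ D ∧ φ w = 3}).ConnectedComponent,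
    c.supp.Nontrivial ∧ ∃ hv : v ∈ {w | w ∈ D ∧ φ w = 3}, (⟨v, hv⟩ : {w | w ∈ D ∧ φ w = 3}) ∈ c.supp

open Classical in
/-- Sending a wave from a vertex `v` in a territory of a stable state `φ`: add a grain at `v`,
topple `v`, freeze `v`, relax, and remove a grain from `v`. Here `u` counts all topplings made and
`φ'` is the state obtained. -/
def IsWave (D : Set (Cyl p q)) (v : Cyl p q) (φ : State p q) (u : Cyl p q → ℕ)
    (φ' : State p q) : Prop :=
  StableOn D φ ∧ InTerritory D φ v ∧
    ∃ (u₀ : Cyl p q → ℕ) (ψ : State p q),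
      Relaxes (D \ {v}) (topple v (φ + grain v)) u₀ ψ ∧
      (u = fun w => u₀ w + if w = v then 1 else 0) ∧
      φ' = ψ - grain v

open Classical in
/-- The maximal stable state: three grains at each internal site. -/
noncomputable def maximalState (D : Set (Cyl p q)) : State p q := fun w => if w ∈ D then 3 else 0

/-- Starting from the maximal stable state one can send `n` waves from `v`; the total number of
topplings is `h` and the state obtained is `φ`. -/
def Waves (D : Set (Cyl p q)) (v : Cyl p q) : ℕ → (Cyl p q → ℕ) → State p q → Prop
  | 0, h, φ => h = 0 ∧ φ = maximalState D
  | n + 1, h, φ => ∃ (h₀ : Cyl p q → ℕ) (φ₀ : State p q) (u : Cyl p q → ℕ),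
      Waves D v n h₀ φ₀ ∧ IsWave D v φ₀ u φ ∧ h = h₀ + u

/-- The set of points `(i,j)` of the strip where `h` differs from `min (pj - qi + k, n)`. -/
def defectSet (p q : ℕ) (h : Cyl p q → ℕ) (k : ℤ) (n : ℕ) : Set (ℤ × ℤ) :=
  {x | x ∈ strip p ∧ (h (site p q x) : ℤ) ≠ min (p * x.2 - q * x.1 + k) n}

/-- The set of points of the strip that represent coloured sites: internal sites with fewer than
three grains. -/
def coloredSet (p q : ℕ) (D : Set (Cyl p q)) (φ : State p q) : Set (ℤ × ℤ) :=
  {x | x ∈ strip p ∧ site p q x ∈ D ∧ φ (site p q x) < 3}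

/-- The box `[0,p] × [a,b]`. -/
def box (p : ℕ) (a b : ℤ) : Set (ℤ × ℤ) := Set.Icc (0, a) ((p : ℤ), b)

/-- The neighbourhood of width `C` of the line `pj - qi + k = n`. -/
def band (p q : ℕ) (k : ℤ) (n C : ℕ) : Set (ℤ × ℤ) :=
  {x | |(p * x.2 - q * x.1 + k - n : ℤ)| ≤ C}

end WaveCylinder

/-!
The toppling function of `n` waves sent from `v` is the least nonnegative function that is at least
`n` at `v` and superharmonic at the other internal sites. The height `pj - qi` identifies the
cylinder with `ℤ`, where the neighbours of `m` are `m ± p` and `m ± q`, and superharmonicity says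
that the flux, a weighted sum of differences of the profile across a window of bounded length, is
nonincreasing. Minimality bounds the profile by a ramp of slope one and its differences by a
constant, so beyond a bounded height the flux is an integer between `0` and `p ^ 2 + q ^ 2`.
Where the flux stays constant the profile is harmonic. By compactness and a Liouville theorem, a
profile harmonic on a long interval has an integer slope, which can only be `0` or `1`: hence the
flux takes its intermediate values on a stretch of bounded length, between a ramp of slope one and
the plateau at level `n`. Profiles increase with `n`, so the offset of the ramp stabilizes.
-/

namespace WaveCylinder

/-! ### Laplacians and wave profiles -/

section Laplacian

variable {G' G : Type*} [AddGroup G'] [AddGroup G]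

/-- The Laplacian of the graph on the group `G` in which the neighbours of `w` are `w ± a` and
`w ± b`; it is used both on the cylinder and on `ℤ`, to which the cylinder is isomorphic. -/
def laplacian (a b : G) (f : G → ℤ) (w : G) : ℤ :=
  f (w + a) + f (w - a) + f (w + b) + f (w - b) - 4 * f w

lemma laplacian_add (a b : G) (f g : G → ℤ) :
    laplacian a b (f + g) = laplacian a b f + laplacian a b g := by
  funext w
  simp only [laplacian, Pi.add_apply]
  ring

lemma laplacian_sub (a b : G) (f g : G → ℤ) :
    laplacian a b (f - g) = laplacian a b f - laplacian a b g := by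
  funext w
  simp only [laplacian, Pi.sub_apply]
  ring

lemma laplacian_const (a b : G) (c : ℤ) : laplacian a b (fun _ => c) = 0 := by
  funext w
  simp only [laplacian, Pi.zero_apply]
  ring

lemma laplacian_comm (a b : G) (f : G → ℤ) : laplacian a b f = laplacian b a f := by
  funext w
  simp only [laplacian]
  ring

lemma laplacian_neg_left (a b : G) (f : G → ℤ) : laplacian (-a) b f = laplacian a b f := by
  funext w
  simp only [laplacian, sub_neg_eq_add, ← sub_eq_add_neg]
  ring

lemma laplacian_comp (e : G →+ G') (a b : G) (f : G' → ℤ) (w : G) :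
    laplacian a b (f ∘ e) w = laplacian (e a) (e b) f (e w) := by
  simp only [laplacian, Function.comp_apply, map_add, map_sub]

lemma laplacian_inf_nonpos {a b : G} {f g : G → ℤ} {w : G}
    (hf : f w ≤ g w → laplacian a b f w ≤ 0) (hg : g w < f w → laplacian a b g w ≤ 0) :
    laplacian a b (f ⊓ g) w ≤ 0 := by
  simp only [laplacian, Pi.inf_apply] at *
  omega

/-- The nonnegative functions with value at least `n` at `v` that are superharmonic on
`D \ {v}`. -/
def supersolutions (a b : G) (D : Set G) (v : G) (n : ℕ) : Set (G → ℤ) :=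
  {f | 0 ≤ f ∧ n ≤ f v ∧ ∀ w ∈ D, w ≠ v → laplacian a b f w ≤ 0}

/-- `h` is the least supersolution; this characterizes the toppling function of `n` waves sent
from `v`. -/
def IsWaveProfile (a b : G) (D : Set G) (v : G) (n : ℕ) (h : G → ℤ) : Prop :=
  IsLeast (supersolutions a b D v n) h

namespace IsWaveProfile

variable {a b : G} {D : Set G} {v : G} {n : ℕ} {h : G → ℤ}

lemma zero : IsWaveProfile a b D v 0 0 :=
  ⟨⟨le_rfl, le_rfl, fun w _ _ => (congrFun (laplacian_const a b 0) w).le⟩, fun _ hf => hf.1⟩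

lemma nonneg (H : IsWaveProfile a b D v n h) : 0 ≤ h := H.1.1

lemma le_level (H : IsWaveProfile a b D v n h) (w : G) : h w ≤ n :=
  H.2 ⟨fun _ => n.cast_nonneg, le_rfl, fun _ _ _ => (congrFun (laplacian_const a b n) _).le⟩ w

lemma apply_source (H : IsWaveProfile a b D v n h) : h v = n :=
  (H.le_level v).antisymm H.1.2.1

lemma laplacian_nonpos (H : IsWaveProfile a b D v n h) {w : G} (hw : w ∈ D) :
    laplacian a b h w ≤ 0 := by
  rcases eq_or_ne w v with rfl | hwv
  · have := H.le_level
    rw [laplacian, H.apply_source]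
    linarith [this (w + a), this (w - a), this (w + b), this (w - b)]
  · exact H.1.2.2 w hw hwv

lemma le_of_le_apply {v' : G} {n' : ℕ} {h' : G → ℤ} (H : IsWaveProfile a b D v n h)
    (H' : IsWaveProfile a b D v' n' h') (hn : n ≤ h' v) : h ≤ h' :=
  H.2 ⟨H'.nonneg, hn, fun _ hw _ => H'.laplacian_nonpos hw⟩

lemma map (H : IsWaveProfile a b D v n h) (e : G ≃+ G') :
    IsWaveProfile (e a) (e b) (e '' D) (e v) n (h ∘ e.symm) := by
  have laplacian_comp_equiv (f : G' → ℤ) (w : G) :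
      laplacian a b (f ∘ e) w = laplacian (e a) (e b) f (e w) :=
    laplacian_comp e.toAddMonoidHom a b f w
  refine ⟨⟨fun m => H.nonneg (e.symm m), by simpa using H.1.2.1, ?_⟩, fun f hf m => ?_⟩
  · rintro _ ⟨w, hw, rfl⟩ hwv
    rw [← laplacian_comp_equiv, Function.comp_assoc, e.symm_comp_self, Function.comp_id]
    exact H.1.2.2 w hw (ne_of_apply_ne e hwv)
  · have hfe : f ∘ e ∈ supersolutions a b D v n := by
      refine ⟨fun w => hf.1 (e w), hf.2.1, fun w hw hwv => ?_⟩
      rw [laplacian_comp_equiv]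
      exact hf.2.2 _ ⟨w, hw, rfl⟩ (e.injective.ne hwv)
    simpa using H.2 hfe (e.symm m)

end IsWaveProfile

end Laplacian

/-! ### The least action principle -/

section Relaxation

variable {p q : ℕ} {A D : Set (Cyl p q)} {v : Cyl p q} {φ φ' ψ : State p q}
  {x : ℕ → Option (Cyl p q)} {u h : Cyl p q → ℕ} {n : ℕ}

local notation "Δ" => laplacian (stepX _ _) (stepY _ _)

lemma topple_eq_add_laplacian (v : Cyl p q) (φ : State p q) :
    topple v φ = φ + Δ (grain v) := by
  funext w
  have grain_add (a : Cyl p q) : grain (v + a) w = grain v (w - a) := by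
    simp only [grain, sub_eq_iff_eq_add]
  have grain_sub (a : Cyl p q) : grain (v - a) w = grain v (w + a) := by
    simp only [grain, eq_sub_iff_add_eq]
  simp only [topple, laplacian, Pi.add_apply, Pi.sub_apply, Pi.smul_apply, grain_add,
    grain_sub]
  ring

open Classical in
/-- The number of topplings at `w` among the first `i` steps of `x`. -/
noncomputable def topplingCount (x : ℕ → Option (Cyl p q)) (i : ℕ) (w : Cyl p q) : ℕ :=
  Nat.count (fun j => x j = some w) i

lemma topplingCount_zero (x : ℕ → Option (Cyl p q)) (w : Cyl p q) : topplingCount x 0 w = 0 :=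
  Nat.count_zero _

open Classical in
lemma topplingCount_succ (x : ℕ → Option (Cyl p q)) (i : ℕ) (w : Cyl p q) :
    topplingCount x (i + 1) w = topplingCount x i w + if x i = some w then 1 else 0 :=
  Nat.count_succ _ _

lemma run_eq_add_laplacian (φ : State p q) (x : ℕ → Option (Cyl p q)) (i : ℕ) :
    run φ x i = φ + Δ (fun w => (topplingCount x i w : ℤ)) := by
  induction i with
  | zero => simp [run, topplingCount_zero, laplacian_const]
  | succ i ih =>
    cases hx : x i with
    | none => simp [run, hx, ih, topplingCount_succ]
    | some v =>
      have count_eq : (fun w => (topplingCount x (i + 1) w : ℤ)) =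
          (fun w => (topplingCount x i w : ℤ)) + grain v := by
        funext w
        simp [topplingCount_succ, hx, grain, eq_comm]
      rw [count_eq, laplacian_add, ← add_assoc, ← ih, ← topple_eq_add_laplacian]
      simp only [run, hx]

lemma eventually_topplingCount_eq {w : Cyl p q} (hfin : {i | x i = some w}.Finite) :
    ∀ᶠ i in Filter.atTop, topplingCount x i w = {i | x i = some w}.ncard := by
  obtain ⟨B, hB⟩ := hfin.bddAbove
  filter_upwards [Filter.eventually_gt_atTop B] with i hi
  rw [topplingCount, Nat.count_eq_card_filter_range, ← Set.ncard_coe_finset]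
  congr 1
  ext j
  simpa using fun hj => (hB hj).trans_lt hi

lemma eventually_run_eq (hu : ∀ w, {i | x i = some w}.Finite ∧ u w = {i | x i = some w}.ncard)
    (w : Cyl p q) :
    ∀ᶠ i in Filter.atTop, run φ x i w = (φ + Δ (fun w => (u w : ℤ))) w := by
  have count_eq (w) : ∀ᶠ i in Filter.atTop, topplingCount x i w = u w := by
    rw [(hu w).2]
    exact eventually_topplingCount_eq (hu w).1
  filter_upwards [count_eq w, count_eq (w + stepX p q), count_eq (w - stepX p q),
    count_eq (w + stepY p q), count_eq (w - stepY p q)] with i h₀ h₁ h₂ h₃ h₄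
  simp only [run_eq_add_laplacian, Pi.add_apply, laplacian, h₀, h₁, h₂, h₃, h₄]

/-- All topplings of the sequence `x`, applied to `φ`, are legal and take place in `A`. -/
def IsLegal (A : Set (Cyl p q)) (φ : State p q) (x : ℕ → Option (Cyl p q)) : Prop :=
  ∀ i w, x i = some w → w ∈ A ∧ 4 ≤ run φ x i w

/-- The toppling functions that stabilize `φ` on `A`, whether or not the topplings are legal. -/
def stabilizers (A : Set (Cyl p q)) (φ : State p q) : Set (Cyl p q → ℤ) :=
  {f | 0 ≤ f ∧ StableOn A (φ + Δ f)}

lemma topplingCount_le (hx : IsLegal A φ x) {f : Cyl p q → ℤ} (hf : f ∈ stabilizers A φ)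
    (i : ℕ) (w : Cyl p q) : topplingCount x i w ≤ f w := by
  induction i generalizing w with
  | zero => exact (topplingCount_zero x w).symm ▸ hf.1 w
  | succ i ih =>
    rw [topplingCount_succ]
    split_ifs with hw
    · obtain ⟨hA, legal⟩ := hx i w hw
      have stable := hf.2 w hA
      have hlt : (topplingCount x i w : ℤ) ≠ f w := fun heq => by
        simp only [run_eq_add_laplacian, Pi.add_apply, laplacian] at legal stable
        linarith [ih (w + stepX p q), ih (w - stepX p q), ih (w + stepY p q), ih (w - stepY p q)]
      have := ih w
      push_cast
      omega
    · exact ih w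

lemma Relaxes.state_eq (hr : Relaxes A φ u ψ) : ψ = φ + Δ (fun w => (u w : ℤ)) := by
  obtain ⟨x, -, hu, hψ, -⟩ := hr
  funext w
  obtain ⟨i, h₁, h₂⟩ := ((hψ w).and (eventually_run_eq hu w)).exists
  rw [← h₁, h₂]

lemma Relaxes.isLeast (hr : Relaxes A φ u ψ) :
    IsLeast (stabilizers A φ) fun w => (u w : ℤ) := by
  refine ⟨⟨fun w => (u w).cast_nonneg, hr.state_eq ▸ hr.choose_spec.2.2.2⟩, fun f hf w => ?_⟩
  obtain ⟨x, hx, hu, -, -⟩ := hr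
  obtain ⟨i, hi⟩ := (eventually_topplingCount_eq (hu w).1).exists
  simp only [(hu w).2, ← hi]
  exact topplingCount_le hx hf i w

lemma exists_frequently_eq (α : Type*) [Countable α] [Nonempty α] :
    ∃ e : ℕ → α, ∀ w, ∃ᶠ i in Filter.atTop, e i = w := by
  obtain ⟨e, he⟩ := exists_surjective_nat α
  refine ⟨fun i => e i.unpair.1, fun w => Filter.frequently_atTop.mpr fun m => ?_⟩
  obtain ⟨j, rfl⟩ := he w
  exact ⟨Nat.pair j m, Nat.right_le_pair j m, by simp⟩

open Classical in
/-- The state after visiting `e 0, …, e (i - 1)` in turn, toppling each visited site of `A` that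
holds at least four grains. -/
noncomputable def greedyState (A : Set (Cyl p q)) (φ : State p q) (e : ℕ → Cyl p q) :
    ℕ → State p q
  | 0 => φ
  | i + 1 => if e i ∈ A ∧ 4 ≤ greedyState A φ e i (e i) then topple (e i) (greedyState A φ e i)
    else greedyState A φ e i

lemma exists_isLegal_frequently (A : Set (Cyl p q)) (φ : State p q) :
    ∃ x, IsLegal A φ x ∧
      ∀ w ∈ A, ∃ᶠ i in Filter.atTop, 4 ≤ run φ x i w → x i = some w := by
  classical
  have : Countable (Cyl p q) := QuotientAddGroup.mk_surjective.countable
  obtain ⟨e, he⟩ := exists_frequently_eq (Cyl p q)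
  let x (i : ℕ) : Option (Cyl p q) :=
    if e i ∈ A ∧ 4 ≤ greedyState A φ e i (e i) then some (e i) else none
  have run_eq (i : ℕ) : run φ x i = greedyState A φ e i := by
    induction i with
    | zero => rfl
    | succ i ih =>
      by_cases hi : e i ∈ A ∧ 4 ≤ greedyState A φ e i (e i) <;>
        simp [run, greedyState, x, hi, ih]
  refine ⟨x, fun i w hw => ?_, fun w hw => (he w).mono ?_⟩
  · obtain ⟨hi, rfl⟩ : (e i ∈ A ∧ 4 ≤ greedyState A φ e i (e i)) ∧ e i = w := by
      simpa only [x, Option.ite_none_right_eq_some, Option.some.injEq] using hw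
    rwa [run_eq]
  · rintro i rfl hi
    exact if_pos ⟨hw, run_eq i ▸ hi⟩

lemma exists_relaxes (hne : (stabilizers A φ).Nonempty) : ∃ u ψ, Relaxes A φ u ψ := by
  obtain ⟨f, hf⟩ := hne
  obtain ⟨x, hx, hfair⟩ := exists_isLegal_frequently A φ
  have hfin (w) : {i | x i = some w}.Finite := by
    classical
    by_contra hinf
    have := topplingCount_le hx hf (Nat.nth (fun i => x i = some w) ((f w).toNat + 1)) w
    rw [topplingCount, Nat.count_nth_of_infinite hinf] at this
    omega
  have hu (w) : {i | x i = some w}.Finite ∧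
      (fun w => {i | x i = some w}.ncard) w = {i | x i = some w}.ncard := ⟨hfin w, rfl⟩
  refine ⟨_, _, x, hx, hu, eventually_run_eq hu, fun w hw => ?_⟩
  by_contra! hunstable
  have : ∃ᶠ i in Filter.atTop, x i = some w :=
    ((hfair w hw).and_eventually (eventually_run_eq hu w)).mono fun i hi =>
      hi.1 (hi.2 ▸ hunstable)
  exact Nat.frequently_atTop_iff_infinite.mp this (hfin w)

/-- The functions that may be the toppling function of a wave sent from `v`, whether or not the
topplings are legal. -/
def waveStabilizers (D : Set (Cyl p q)) (v : Cyl p q) (φ : State p q) : Set (Cyl p q → ℤ) :=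
  {f | 0 ≤ f ∧ 1 ≤ f v ∧ StableOn (D \ {v}) (φ + Δ f)}

lemma sub_grain_mem_stabilizers_iff {f : Cyl p q → ℤ} :
    f - grain v ∈ stabilizers (D \ {v}) (topple v (φ + grain v)) ↔ f ∈ waveStabilizers D v φ := by
  have nonneg_iff : 0 ≤ f - grain v ↔ 0 ≤ f ∧ 1 ≤ f v := by
    refine ⟨fun hf => ⟨fun w => ?_, ?_⟩, fun hf w => ?_⟩
    · have := hf w
      simp only [grain, Pi.zero_apply, Pi.sub_apply] at this ⊢
      split_ifs at this <;> omega
    · simpa [grain] using hf v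
    · rcases eq_or_ne w v with rfl | hw
      · simpa [grain] using hf.2
      · simpa [grain, hw] using hf.1 w
  have state_eq : topple v (φ + grain v) + Δ (f - grain v) = φ + Δ f + grain v := by
    rw [topple_eq_add_laplacian, laplacian_sub]
    abel
  have stable_iff : StableOn (D \ {v}) (φ + Δ f + grain v) ↔ StableOn (D \ {v}) (φ + Δ f) :=
    forall₂_congr fun w hw => by simp [grain, show w ≠ v from hw.2]
  rw [stabilizers, waveStabilizers, Set.mem_ofPred_eq, Set.mem_ofPred_eq, nonneg_iff, state_eq,
    stable_iff, and_assoc]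

lemma IsWave.exists_relaxes (hw : IsWave D v φ u φ') :
    ∃ u₀ ψ, Relaxes (D \ {v}) (topple v (φ + grain v)) u₀ ψ ∧
      (fun w => (u w : ℤ)) = (fun w => (u₀ w : ℤ)) + grain v ∧ φ' = ψ - grain v := by
  obtain ⟨-, -, u₀, ψ, hr, rfl, hφ'⟩ := hw
  refine ⟨u₀, ψ, hr, ?_, hφ'⟩
  funext w
  simp [grain]

lemma IsWave.state_eq (hw : IsWave D v φ u φ') : φ' = φ + Δ (fun w => (u w : ℤ)) := by
  obtain ⟨u₀, ψ, hr, hu, rfl⟩ := hw.exists_relaxes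
  rw [hr.state_eq, topple_eq_add_laplacian, hu, laplacian_add]
  abel

lemma IsWave.isLeast (hw : IsWave D v φ u φ') :
    IsLeast (waveStabilizers D v φ) fun w => (u w : ℤ) := by
  obtain ⟨u₀, ψ, hr, hu, -⟩ := hw.exists_relaxes
  rw [hu]
  refine ⟨sub_grain_mem_stabilizers_iff.mp ?_, fun f hf => le_sub_iff_add_le.mp ?_⟩
  · rw [add_sub_cancel_right]
    exact hr.isLeast.1
  · exact hr.isLeast.2 (sub_grain_mem_stabilizers_iff.mpr hf)

lemma exists_isWave (hs : StableOn D φ) (ht : InTerritory D φ v)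
    (hne : (waveStabilizers D v φ).Nonempty) : ∃ u φ', IsWave D v φ u φ' := by
  obtain ⟨f, hf⟩ := hne
  obtain ⟨u₀, ψ, hr⟩ := exists_relaxes ⟨_, sub_grain_mem_stabilizers_iff.mpr hf⟩
  exact ⟨_, _, hs, ht, u₀, ψ, hr, rfl, rfl⟩

lemma maximalState_of_mem {w : Cyl p q} (hw : w ∈ D) : maximalState D w = 3 := if_pos hw

namespace Waves

lemma state_eq (hw : Waves D v n h φ) : φ = maximalState D + Δ (fun w => (h w : ℤ)) := by
  induction n generalizing h φ with
  | zero =>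
    obtain ⟨rfl, rfl⟩ := hw
    simp [laplacian_const]
  | succ n ih =>
    obtain ⟨h₀, φ₀, u, hw₀, hu, rfl⟩ := hw
    have count_eq : (fun w => ((h₀ + u) w : ℤ)) = (fun w => (h₀ w : ℤ)) + fun w => (u w : ℤ) := by
      funext w
      simp
    rw [hu.state_eq, ih hw₀, count_eq, laplacian_add, add_assoc]

lemma apply_eq (hw : Waves D v n h φ) {w : Cyl p q} (hwD : w ∈ D) :
    φ w = 3 + Δ (fun w => (h w : ℤ)) w := by
  rw [hw.state_eq, Pi.add_apply, maximalState_of_mem hwD]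

lemma isWaveProfile (hw : Waves D v n h φ) :
    IsWaveProfile (stepX p q) (stepY p q) D v n fun w => (h w : ℤ) := by
  induction n generalizing h φ with
  | zero =>
    obtain ⟨rfl, -⟩ := hw
    exact IsWaveProfile.zero
  | succ n ih =>
    have apply_eq {w} (hwD : w ∈ D) := hw.apply_eq hwD
    obtain ⟨h₀, φ₀, u, hw₀, hu, rfl⟩ := hw
    have H₀ := ih hw₀
    have h₀_source : (h₀ v : ℤ) = n := H₀.apply_source
    obtain ⟨⟨-, (one_le : (1 : ℤ) ≤ u v), stable⟩, least⟩ := hu.isLeast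
    refine ⟨⟨fun w => Nat.cast_nonneg _, ?_, fun w hwD hwv => ?_⟩, fun f hf => ?_⟩
    · simp only [Pi.add_apply]
      omega
    · have := stable w ⟨hwD, hwv⟩
      rw [← hu.state_eq, apply_eq hwD] at this
      omega
    · have source_le : (n : ℤ) + 1 ≤ f v := mod_cast hf.2.1
      have h₀_le : (fun w => (h₀ w : ℤ)) ≤ f := H₀.2 ⟨hf.1, by omega, hf.2.2⟩
      have hsub : f - (fun w => (h₀ w : ℤ)) ∈ waveStabilizers D v φ₀ := by
        refine ⟨sub_nonneg.mpr h₀_le, ?_, fun w hwD => ?_⟩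
        · simp only [Pi.sub_apply]
          omega
        · have := hf.2.2 w hwD.1 hwD.2
          simp only [laplacian_sub, Pi.add_apply, Pi.sub_apply, hw₀.apply_eq hwD.1]
          omega
      intro w
      have : (u w : ℤ) ≤ f w - h₀ w := least hsub w
      simp only [Pi.add_apply]
      omega

lemma exists_succ (hw : Waves D v n h φ) (ht : InTerritory D φ v) :
    ∃ h' φ', Waves D v (n + 1) h' φ' := by
  have H := hw.isWaveProfile
  have hstable : StableOn D φ := fun w hwD => by
    have := H.laplacian_nonpos hwD
    rw [hw.apply_eq hwD]
    omega
  -- Topplings complementary to those already made lead back to the maximal stable state.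
  have hmem : (fun _ => (n + 1 : ℤ)) - (fun w => (h w : ℤ)) ∈ waveStabilizers D v φ := by
    refine ⟨fun w => ?_, ?_, fun w hwD => ?_⟩
    · have := H.le_level w
      simp only [Pi.zero_apply, Pi.sub_apply]
      omega
    · have := H.apply_source
      simp only [Pi.sub_apply]
      omega
    · simp [laplacian_sub, laplacian_const, hw.apply_eq hwD.1]
  obtain ⟨u, φ', hu⟩ := exists_isWave hstable ht ⟨_, hmem⟩
  exact ⟨_, _, h, φ, u, hw, hu, rfl⟩

end Waves

end Relaxation

/-! ### Superharmonic functions on the line -/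

section Line

variable {p q : ℕ}

lemma exists_mul_sub_mul_eq (hp : 0 < p) (hpq : p.Coprime q) (m : ℤ) :
    ∃ i j : ℤ, 0 ≤ i ∧ i < p ∧ p * j - q * i = m := by
  obtain ⟨a, b, hab⟩ := Nat.isCoprime_iff_coprime.mpr hpq
  refine ⟨-(b * m) % p, m * a - q * (-(b * m) / p), Int.emod_nonneg _ (by omega),
    Int.emod_lt_of_pos _ (by omega), ?_⟩
  linear_combination m * hab - q * Int.mul_ediv_add_emod (-(b * m)) p

lemma forall_ge_of_step (hp : 0 < p) (hq : 0 < q) (hpq : p.Coprime q) {Q : ℤ → Prop} {M y : ℤ}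
    (hy : M ≤ y) (hQ : Q y) (up : ∀ x, M ≤ x → Q x → Q (x + p))
    (down : ∀ x, M ≤ x → Q x → Q (x - q)) {z : ℤ} (hz : M ≤ z) : Q z := by
  obtain ⟨s, t, hst⟩ : ∃ s t : ℕ, (p * s - q * t : ℤ) = z - y := by
    obtain ⟨i, j, hi, -, hij⟩ := exists_mul_sub_mul_eq hp hpq (z - y)
    have : |j| ≤ |j| * q := le_mul_of_one_le_right (abs_nonneg j) (mod_cast hq)
    refine ⟨(j + |j| * q).toNat, (i + |j| * p).toNat, ?_⟩
    rw [Int.toNat_of_nonneg (by linarith [neg_abs_le j]), Int.toNat_of_nonneg (by positivity)]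
    linear_combination hij
  have climb (s : ℕ) : Q (y + p * s) := by
    induction s with
    | zero => simpa using hQ
    | succ s ih =>
      have := up _ (hy.trans (le_add_of_nonneg_right (by positivity))) ih
      convert this using 1
      push_cast
      ring
  -- Descending only after all the ascents, the walk stays above its endpoint `z`.
  have descend (r : ℕ) (hr : r ≤ t) : Q (y + p * s - q * r) := by
    induction r with
    | zero => simpa using climb s
    | succ r ih =>
      have : (q * r : ℤ) ≤ q * t := by gcongr; omega
      have := down _ (by linarith) (ih (by omega))
      convert this using 1
      push_cast
      ring
  have := descend t le_rfl
  rwa [show y + p * s - q * t = z by linarith] at this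

lemma eq_of_superharmonic_of_eq (hp : 0 < p) (hq : 0 < q) (hpq : p.Coprime q) {f : ℤ → ℤ}
    {M c y : ℤ} (hf : ∀ m, M ≤ m → laplacian (p : ℤ) q f m ≤ 0)
    (hc : ∀ m, M - (p + q) ≤ m → c ≤ f m) (hy : M ≤ y) (hfy : f y = c) {z : ℤ} (hz : M ≤ z) :
    f z = c := by
  have neighbours {x : ℤ} (hx : M ≤ x) (hfx : f x = c) : f (x + p) = c ∧ f (x - q) = c := by
    have := hf x hx
    rw [laplacian] at this
    have := hc (x + p) (by omega)
    have := hc (x - p) (by omega)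
    have := hc (x + q) (by omega)
    have := hc (x - q) (by omega)
    omega
  exact forall_ge_of_step (Q := fun x => f x = c) hp hq hpq hy hfy
    (fun x hx hfx => (neighbours hx hfx).1) (fun x hx hfx => (neighbours hx hfx).2) hz

lemma natCast_le_of_superharmonic (hp : 0 < p) (hq : 0 < q) (hpq : p.Coprime q) {f : ℤ → ℤ}
    {M v : ℤ} {n : ℕ} (hf₀ : 0 ≤ f) (hf : ∀ m, M ≤ m → laplacian (p : ℤ) q f m ≤ 0)
    (hv : M + n * (p + q) ≤ v) (hn : n ≤ f v) {m : ℤ} (hm : M + n * (p + q) ≤ m) : n ≤ f m := by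
  induction n generalizing m with
  | zero => simpa using hf₀ m
  | succ n ih =>
    push_cast at hv hn hm ⊢
    have hM : M ≤ M + (n + 1) * (p + q) := le_add_of_nonneg_right (by positivity)
    have le_f {x : ℤ} (hx : M + (n + 1) * (p + q) - (p + q) ≤ x) : n ≤ f x :=
      ih (by linarith) (by linarith) (by linarith)
    by_contra! hlt
    have := eq_of_superharmonic_of_eq hp hq hpq (c := n) (fun x hx => hf x (hM.trans hx))
      (fun x => le_f) hm (le_antisymm (by omega) (le_f (by omega))) hv
    omega

lemma eq_of_superharmonic_of_bddBelow (hp : 0 < p) (hq : 0 < q) (hpq : p.Coprime q) {f : ℤ → ℤ}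
    {c : ℤ} (hf : ∀ m, laplacian (p : ℤ) q f m ≤ 0) (hc : ∀ m, c ≤ f m) (y z : ℤ) :
    f y = f z := by
  obtain ⟨_, ⟨x, rfl⟩, hx⟩ := Int.exists_least_of_bdd (P := (· ∈ Set.range f))
    ⟨c, Set.forall_mem_range.mpr hc⟩ ⟨f 0, 0, rfl⟩
  have eq_min (z : ℤ) : f z = f x :=
    eq_of_superharmonic_of_eq hp hq hpq (M := min x z) (fun m _ => hf m) (fun m _ => hx _ ⟨m, rfl⟩)
      (min_le_left _ _) rfl (min_le_right _ _)
  rw [eq_min, eq_min z]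

end Line

/-! ### Flux -/

section Flux

open Finset

variable {p q A n : ℕ} {f g h : ℤ → ℤ} {m : ℤ}

/-- The sum of the values of `f` at the `r` consecutive integers starting from `m`. -/
def boxSum (r : ℕ) (f : ℤ → ℤ) (m : ℤ) : ℤ := ∑ i ∈ range r, f (m + i)

/-- The sum of the values of `f` around `m`, with weights of total mass `p ^ 2 + q ^ 2` whose
convolution with the second difference operator is the Laplacian. -/
def smear (p q : ℕ) (f : ℤ → ℤ) (m : ℤ) : ℤ :=
  boxSum p (boxSum p f) (m + 1 - p) + boxSum q (boxSum q f) (m + 1 - q)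

/-- The smeared gradient of `h`, whose increments are the values of the Laplacian of `h`. -/
def flux (p q : ℕ) (h : ℤ → ℤ) : ℤ → ℤ := smear p q (fwdDiff 1 h)

lemma boxSum_fwdDiff (r : ℕ) (f : ℤ → ℤ) (m : ℤ) :
    boxSum r (fwdDiff 1 f) m = f (m + r) - f m := by
  simpa [boxSum, fwdDiff, add_assoc] using sum_range_sub (fun i : ℕ => f (m + i)) r

lemma boxSum_add_one (r : ℕ) (f : ℤ → ℤ) (m : ℤ) :
    boxSum r f (m + 1) = boxSum r f m + (f (m + r) - f m) := by
  rw [← boxSum_fwdDiff]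
  simp only [boxSum, fwdDiff, sum_sub_distrib, add_right_comm m _ 1, add_sub_cancel]

lemma boxSum_boxSum_le_boxSum_boxSum (r : ℕ) (hfg : ∀ x, |x - m| < r → f x ≤ g x) :
    boxSum r (boxSum r f) (m + 1 - r) ≤ boxSum r (boxSum r g) (m + 1 - r) := by
  refine sum_le_sum fun i hi => sum_le_sum fun j hj => hfg _ ?_
  rw [mem_range] at hi hj
  rw [abs_lt]
  omega

lemma smear_le_smear (hfg : ∀ x, |x - m| < p + q → f x ≤ g x) : smear p q f m ≤ smear p q g m :=
  add_le_add (boxSum_boxSum_le_boxSum_boxSum p fun x hx => hfg x (by omega))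
    (boxSum_boxSum_le_boxSum_boxSum q fun x hx => hfg x (by omega))

lemma smear_eq_of_forall_eq {c : ℤ} (hf : ∀ x, |x - m| < p + q → f x = c) :
    smear p q f m = smear p q (fun _ => c) m :=
  le_antisymm (smear_le_smear fun x hx => (hf x hx).le) (smear_le_smear fun x hx => (hf x hx).ge)

lemma smear_const (p q : ℕ) (c m : ℤ) : smear p q (fun _ => c) m = (p ^ 2 + q ^ 2) * c := by
  simp only [smear, boxSum, sum_const, card_range, nsmul_eq_mul]
  ring

lemma flux_eq_smear_sub_smear (p q : ℕ) (h : ℤ → ℤ) (m : ℤ) :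
    flux p q h m = smear p q h (m + 1) - smear p q h m := by
  simp only [flux, smear, boxSum, fwdDiff, sum_sub_distrib]
  ring_nf

lemma flux_add_one (p q : ℕ) (h : ℤ → ℤ) (m : ℤ) :
    flux p q h (m + 1) = flux p q h m + laplacian (p : ℤ) q h (m + 1) := by
  have second_difference (r : ℕ) : boxSum r (boxSum r (fwdDiff 1 h)) (m + 1 + 1 - r) =
      boxSum r (boxSum r (fwdDiff 1 h)) (m + 1 - r) +
        (h (m + 1 + r) + h (m + 1 - r) - 2 * h (m + 1)) := by
    rw [add_sub_right_comm (m + 1), boxSum_add_one, boxSum_fwdDiff, boxSum_fwdDiff]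
    simp only [sub_add_cancel]
    ring
  simp only [flux, smear, second_difference, laplacian]
  ring

lemma antitoneOn_flux (hh : ∀ x : ℤ, A < x → laplacian (p : ℤ) q h x ≤ 0) :
    AntitoneOn (flux p q h) (Set.Ici (A : ℤ)) := by
  refine antitoneOn_of_succ_le Set.ordConnected_Ici fun m _ hm _ => ?_
  have := hh (m + 1) (Int.lt_add_one_of_le hm)
  rw [Order.succ_eq_add_one, flux_add_one]
  omega

/- A flux above `p ^ 2 + q ^ 2` on a long interval would make the smeared `h` grow faster than a
function of slope one. -/
lemma flux_le_of_le_max {K : ℕ} (nonneg : 0 ≤ h) (le_max : ∀ x, h x ≤ max (x + K) 0)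
    (hh : ∀ x : ℤ, A < x → laplacian (p : ℤ) q h x ≤ 0)
    (hm : (p ^ 2 + q ^ 2 + 1) * A + (p ^ 2 + q ^ 2) * (p + q + K) < m) :
    flux p q h m ≤ p ^ 2 + q ^ 2 := by
  by_contra! hlt
  have hAm : A ≤ m := by nlinarith [sq_nonneg (p : ℤ), sq_nonneg (q : ℤ)]
  have le_smear (x : ℤ) (hx : A ≤ x) : x ≤ m → (p ^ 2 + q ^ 2 + 1) * (x - A) ≤ smear p q h x := by
    induction x, hx using Int.leInduction with
    | base =>
      have := smear_le_smear (p := p) (q := q) (f := fun _ => 0) (m := A) fun x _ => nonneg x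
      simpa [smear_const] using fun _ => this
    | succ x hx ih =>
      intro hxm
      have := ih (by omega)
      have := antitoneOn_flux hh hx hAm (by omega)
      have := flux_eq_smear_sub_smear p q h x
      linarith
  have smear_le : smear p q h m ≤ (p ^ 2 + q ^ 2) * (m + p + q + K) := by
    rw [← smear_const p q _ m]
    refine smear_le_smear fun x hx => (le_max x).trans ?_
    rw [abs_lt] at hx
    omega
  linarith [le_smear m hAm le_rfl]

lemma exists_radius_smear_eq_of_harmonic (hp : 0 < p) (hq : 0 < q) (hpq : p.Coprime q) (G : ℤ) :
    ∃ R : ℕ, ∀ (g : ℤ → ℤ) (m : ℤ), (∀ x, |g x| ≤ G) →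
      (∀ x, |x - m| ≤ R → laplacian (p : ℤ) q g x = 0) →
      smear p q g m = (p ^ 2 + q ^ 2) * g m := by
  by_contra! hcounter
  let K (R : ℕ) : Set (ℤ → ℤ) := {g | (∀ x, g x ∈ Set.Icc (-G) G) ∧
    smear p q g 0 ≠ (p ^ 2 + q ^ 2) * g 0 ∧ ∀ x : ℤ, |x| ≤ R → laplacian (p : ℤ) q g x = 0}
  have K_antitone (R : ℕ) : K (R + 1) ⊆ K R := fun g hg =>
    ⟨hg.1, hg.2.1, fun x hx => hg.2.2 x (hx.trans (by simp))⟩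
  have K_nonempty (R : ℕ) : (K R).Nonempty := by
    obtain ⟨g, m, hG, harm, hne⟩ := hcounter R
    refine ⟨fun x => g (m + x), fun x => abs_le.mp (hG _), ?_, fun x hx => ?_⟩
    · simpa only [smear, boxSum, zero_add, add_zero, ← add_assoc, ← add_sub_assoc] using hne
    · simpa only [laplacian, add_assoc, add_sub_assoc] using harm (m + x) (by simpa using hx)
  have K_closed (R : ℕ) : IsClosed (K R) := by
    simp only [K, Set.ofPred_and, Set.ofPred_forall]
    refine (isClosed_iInter fun x => ?_).inter (.inter ?_ (isClosed_iInter fun x =>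
      isClosed_iInter fun _ => ?_))
    · exact isClosed_Icc.preimage (continuous_apply x)
    · exact (isClosed_discrete {z : ℤ × ℤ | z.1 ≠ (p ^ 2 + q ^ 2) * z.2}).preimage
        (f := fun g : ℤ → ℤ => (smear p q g 0, g 0)) (by unfold smear boxSum; fun_prop)
    · exact isClosed_eq (by unfold laplacian; fun_prop) continuous_const
  have K_compact : IsCompact (K 0) :=
    (isCompact_univ_pi fun _ => isCompact_Icc).of_isClosed_subset (K_closed 0)
      fun g hg x _ => hg.1 x
  obtain ⟨g, hg⟩ := IsCompact.nonempty_iInter_of_sequence_nonempty_isCompact_isClosed K K_antitone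
    K_nonempty K_compact K_closed
  have hgK (R : ℕ) : g ∈ K R := Set.mem_iInter.mp hg R
  have g_const : g = fun _ => g 0 := funext fun x =>
    eq_of_superharmonic_of_bddBelow hp hq hpq
      (fun x => ((hgK x.natAbs).2.2 x (Int.abs_eq_natAbs x).le).le) (fun x => ((hgK 0).1 x).1) x 0
  refine (hgK 0).2.1 ?_
  rw [g_const, smear_const]

lemma exists_radius_flux_eq (hp : 0 < p) (hq : 0 < q) (hpq : p.Coprime q) (G : ℤ) :
    ∃ L : ℕ, ∀ (h : ℤ → ℤ) (m : ℤ), (∀ x, |fwdDiff 1 h x| ≤ G) →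
      (∀ x, |x - m| ≤ L → flux p q h x = flux p q h m) →
      flux p q h m = (p ^ 2 + q ^ 2) * fwdDiff 1 h m := by
  obtain ⟨R, hR⟩ := exists_radius_smear_eq_of_harmonic hp hq hpq G
  refine ⟨R + 1, fun h m hG hconst => hR _ m hG fun x hx => ?_⟩
  have laplacian_fwdDiff : laplacian (p : ℤ) q (fwdDiff 1 h) x =
      laplacian (p : ℤ) q h (x + 1) - laplacian (p : ℤ) q h x := by
    simp only [laplacian, fwdDiff]
    ring_nf
  have near (y : ℤ) (hy : |y - x| ≤ 1) : flux p q h y = flux p q h m := by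
    refine hconst y ?_
    rw [abs_le] at *
    push_cast
    omega
  have right := flux_add_one p q h x
  have left := flux_add_one p q h (x - 1)
  rw [sub_add_cancel] at left
  linarith [near (x + 1) (by simp), near x (by simp), near (x - 1) (by simp)]

lemma exists_jump_of_antitoneOn {F : ℤ → ℤ} {a : ℤ} {P L : ℕ} (hP : 0 < P)
    (hF : AntitoneOn F (Set.Ici a)) (ha : F a ≤ P) (hF₀ : ∀ᶠ m in Filter.atTop, F m = 0)
    (drop : ∀ m, a ≤ m → 0 < F m → F m < P → F (m + L) < F m) :
    ∃ β, (∀ m, a ≤ m → m < β → F m = P) ∧ ∀ m, β + P * L ≤ m → F m = 0 := by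
  obtain ⟨M, hM⟩ := Filter.eventually_atTop.mp hF₀
  have nonneg {m : ℤ} (hm : a ≤ m) : 0 ≤ F m :=
    (hM _ (le_max_right m M)).symm.trans_le (hF hm (le_max_of_le_left hm) (le_max_left m M))
  obtain ⟨β, ⟨hβ, hβP⟩, β_least⟩ := Int.exists_least_of_bdd (P := fun m => a ≤ m ∧ F m < P)
    ⟨a, fun _ hm => hm.1⟩ ⟨max a M, le_max_left a M, by rw [hM _ (le_max_right a M)]; omega⟩
  have le_add (j : ℕ) : a ≤ β + j * L := hβ.trans (le_add_of_nonneg_right (by positivity))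
  have decay (j : ℕ) : F (β + j * L) = 0 ∨ F (β + j * L) + j < P := by
    induction j with
    | zero => simpa using .inr hβP
    | succ j ih =>
      have step : β + (j + 1 : ℕ) * L = β + j * L + L := by push_cast; ring
      have := hF (le_add j) (le_add (j + 1)) (by omega)
      have := drop _ (le_add j)
      have := nonneg (le_add (j + 1))
      rw [step] at *
      push_cast
      omega
  refine ⟨β, fun m hm hmβ => ?_, fun m hm => ?_⟩
  · by_contra hne
    have := hF (Set.self_mem_Ici) hm hm
    have := β_least m ⟨hm, by omega⟩
    omega
  · have := hF (le_add P) ((le_add P).trans hm) hm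
    have := nonneg ((le_add P).trans hm)
    have := nonneg (le_add P)
    have := decay P
    omega

lemma eq_add_mul_of_fwdDiff_eq {a b d : ℤ} (hd : ∀ x, a ≤ x → x < b → fwdDiff 1 f x = d)
    (ham : a ≤ m) (hmb : m ≤ b) : f m = f a + d * (m - a) := by
  induction m, ham using Int.leInduction with
  | base => ring
  | succ m ham ih =>
    have := hd m ham hmb
    rw [fwdDiff, sub_eq_iff_eq_add, ih (by omega)] at this
    rw [this]
    ring

/-- A priori estimates, uniform in the number `n` of waves, that determine the shape of a wave
profile on the line; all constants are bounded by the single number `A`. -/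
structure IsTame (p q A n : ℕ) (h : ℤ → ℤ) : Prop where
  nonneg : 0 ≤ h
  le_max (m : ℤ) : h m ≤ max (m + A) 0
  abs_fwdDiff_le (m : ℤ) : |fwdDiff 1 h m| ≤ A
  laplacian_nonpos (m : ℤ) (hm : A < m) : laplacian (p : ℤ) q h m ≤ 0
  eventually_eq : ∀ᶠ m in Filter.atTop, h m = n

namespace IsTame

lemma eventually_flux_eq_zero (H : IsTame p q A n h) :
    ∀ᶠ m in Filter.atTop, flux p q h m = 0 := by
  obtain ⟨M, hM⟩ := Filter.eventually_atTop.mp H.eventually_eq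
  filter_upwards [Filter.eventually_ge_atTop (M + p + q)] with m hm
  have fwdDiff_eq_zero (x : ℤ) (hx : |x - m| < p + q) : fwdDiff 1 h x = 0 := by
    rw [abs_lt] at hx
    rw [fwdDiff, hM _ (by omega), hM _ (by omega), sub_self]
  rw [flux, smear_eq_of_forall_eq fwdDiff_eq_zero, smear_const, mul_zero]

lemma exists_flux_jump (hp : 0 < p) (hq : 0 < q) (hpq : p.Coprime q) (A : ℕ) :
    ∃ a L : ℕ, ∀ n h, IsTame p q A n h →
      ∃ β : ℤ, (∀ m : ℤ, a ≤ m → m < β → flux p q h m = p ^ 2 + q ^ 2) ∧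
        ∀ m, β + L ≤ m → flux p q h m = 0 := by
  obtain ⟨L, hL⟩ := exists_radius_flux_eq hp hq hpq A
  let P := p ^ 2 + q ^ 2
  let a := (P + 1) * A + P * (p + q + A) + 1
  refine ⟨a, P * (2 * L), fun n h H => ?_⟩
  have hAa : A ≤ a := by
    have : A ≤ (P + 1) * A := Nat.le_mul_of_pos_left A P.succ_pos
    omega
  have flux_anti : AntitoneOn (flux p q h) (Set.Ici (a : ℤ)) :=
    (antitoneOn_flux H.laplacian_nonpos).mono (Set.Ici_subset_Ici.mpr (mod_cast hAa))
  have flux_le : flux p q h a ≤ P := by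
    have := flux_le_of_le_max H.nonneg H.le_max H.laplacian_nonpos (m := a)
      (by simp only [a, P]; push_cast; omega)
    simpa [P] using this
  have drop (m : ℤ) (hm : a ≤ m) (hpos : 0 < flux p q h m) (hlt : flux p q h m < P) :
      flux p q h (m + (2 * L : ℕ)) < flux p q h m := by
    by_contra! hge
    have flux_const (x : ℤ) (hmx : m ≤ x) (hx : x ≤ m + (2 * L : ℕ)) :
        flux p q h x = flux p q h m :=
      (flux_anti hm (hm.trans hmx) hmx).antisymm
        (hge.trans (flux_anti (hm.trans hmx) (hm.trans (hmx.trans hx)) hx))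
    have flux_eq := hL h (m + L) H.abs_fwdDiff_le fun x hx => by
      rw [abs_le] at hx
      rw [flux_const x (by omega) (by omega), flux_const (m + L) (by omega) (by omega)]
    rw [flux_const (m + L) (by omega) (by omega)] at flux_eq
    have : (P : ℤ) ∣ flux p q h m := ⟨_, by simpa [P] using flux_eq⟩
    exact absurd (Int.le_of_dvd hpos this) hlt.not_ge
  simpa [P] using exists_jump_of_antitoneOn (by positivity) flux_anti flux_le
    H.eventually_flux_eq_zero drop

lemma exists_ramp (hp : 0 < p) (hq : 0 < q) (hpq : p.Coprime q) (A : ℕ) :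
    ∃ c W : ℕ, ∀ n h, IsTame p q A n h →
      ∃ β : ℤ, (∀ m : ℤ, c ≤ m → m ≤ β → h m = m + (h c - c)) ∧ ∀ m, β + W ≤ m → h m = n := by
  obtain ⟨a, W, jump⟩ := exists_flux_jump hp hq hpq A
  obtain ⟨L, hL⟩ := exists_radius_flux_eq hp hq hpq A
  refine ⟨a + L, W + 2 * L, fun n h H => ?_⟩
  obtain ⟨β, flux_eq, flux_eq_zero⟩ := jump n h H
  have slope_eq {x d : ℤ} (hx : ∀ y, |y - x| ≤ L → flux p q h y = (p ^ 2 + q ^ 2) * d) :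
      fwdDiff 1 h x = d := by
    have := hL h x H.abs_fwdDiff_le fun y hy => (hx y hy).trans (hx x (by simp)).symm
    rw [hx x (by simp)] at this
    exact (mul_left_cancel₀ (by positivity) this).symm
  refine ⟨β - L, fun m hm hmβ => ?_, fun m hm => ?_⟩
  · have slope_one (x : ℤ) (hx : (a + L : ℕ) ≤ x) (hxm : x < m) : fwdDiff 1 h x = 1 :=
      slope_eq fun y hy => by
        rw [abs_le] at hy
        rw [mul_one, flux_eq y (by omega) (by omega)]
    rw [eq_add_mul_of_fwdDiff_eq slope_one hm le_rfl]
    ring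
  · have slope_zero (x : ℤ) (hx : m ≤ x) : fwdDiff 1 h x = 0 :=
      slope_eq fun y hy => by
        rw [abs_le] at hy
        rw [mul_zero, flux_eq_zero y (by omega)]
    obtain ⟨M, hmM, hM⟩ := (H.eventually_eq.and (Filter.eventually_ge_atTop m)).exists
    rw [← hmM, eq_add_mul_of_fwdDiff_eq (fun x hx _ => slope_zero x hx) hM le_rfl]
    ring

end IsTame

end Flux

/-! ### Wave profiles on the line -/

section LineProfile

variable {p q A n : ℕ} {D : Set ℤ} {v k m : ℤ} {h : ℤ → ℤ}

/-- Either `h` differs at `m` from the ramp of offset `k` truncated at level `n`, or `m` is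
coloured. -/
def IsDefect (p q : ℕ) (k : ℤ) (n : ℕ) (h : ℤ → ℤ) (m : ℤ) : Prop :=
  h m ≠ min (m + k) n ∨ laplacian (p : ℤ) q h m ≠ 0

lemma lt_of_isDefect_of_eq_const (hm : IsDefect p q k n h m)
    (hh : ∀ x, |x - m| ≤ p + q → h x = n) : m + k < n := by
  simp only [IsDefect, laplacian] at hm
  have := hh m (by rw [sub_self, abs_zero]; positivity)
  have := hh (m + p) (by simp)
  have := hh (m - p) (by simp)
  have := hh (m + q) (by simp)
  have := hh (m - q) (by simp)
  omega

lemma lt_of_isDefect_of_eq_add (hm : IsDefect p q k n h m)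
    (hh : ∀ x, |x - m| ≤ p + q → h x = x + k) : n < m + k := by
  simp only [IsDefect, laplacian] at hm
  have := hh m (by rw [sub_self, abs_zero]; positivity)
  have := hh (m + p) (by simp)
  have := hh (m - p) (by simp)
  have := hh (m + q) (by simp)
  have := hh (m - q) (by simp)
  omega

lemma IsTame.abs_add_sub_le (H : IsTame p q A n h) (m : ℤ) (r : ℕ) :
    |h (m + r) - h m| ≤ A * r := by
  induction r with
  | zero => simp
  | succ r ih =>
    have := H.abs_fwdDiff_le (m + r)
    rw [fwdDiff, add_assoc] at this
    push_cast
    rw [abs_le] at *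
    constructor <;> linarith

lemma IsTame.exists_abs_le_of_isDefect (hp : 0 < p) (hq : 0 < q) (hpq : p.Coprime q) (A : ℕ) :
    ∃ c C : ℕ, ∀ n h, IsTame p q A n h → ∀ m : ℤ, C < m → IsDefect p q (h c - c) n h m →
      |m + (h c - c) - n| ≤ C := by
  obtain ⟨c, W, ramp⟩ := IsTame.exists_ramp hp hq hpq A
  refine ⟨c, c + W + p + q + A * W, fun n h H m hm hdef => ?_⟩
  obtain ⟨β, eq_add, eq_level⟩ := ramp n h H
  rcases lt_or_ge β c with hβ | hβ
  · have := H.abs_add_sub_le c W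
    rw [eq_level (c + W) (by omega), abs_le] at this
    have := lt_of_isDefect_of_eq_const hdef fun x hx => eq_level x (by rw [abs_le] at hx; omega)
    omega
  · have := H.abs_add_sub_le β W
    rw [eq_level (β + W) le_rfl, eq_add β hβ le_rfl] at this
    rw [abs_le] at this ⊢
    rcases le_or_gt (m + (p + q)) β with hmβ | hmβ
    · have := lt_of_isDefect_of_eq_add hdef fun x hx =>
        eq_add x (by rw [abs_le] at hx; omega) (by rw [abs_le] at hx; omega)
      omega
    · rcases le_or_gt (β + W) (m - (p + q)) with hβm | hβm
      · have := lt_of_isDefect_of_eq_const hdef fun x hx =>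
          eq_level x (by rw [abs_le] at hx; omega)
        omega
      · omega

/-- From this height on, `n` waves sent from a sufficiently high source topple every site `n`
times. -/
def flatHeight (p q A n : ℕ) : ℤ := A + 1 + n * (p + q)

lemma flatHeight_mono (p q A : ℕ) : Monotone (flatHeight p q A) := fun m n hmn => by
  unfold flatHeight
  gcongr

namespace IsWaveProfile

lemma natCast_le (hp : 0 < p) (hq : 0 < q) (hpq : p.Coprime q)
    (hD : ∀ m : ℤ, A < m → m ∈ D) (H : IsWaveProfile (p : ℤ) q D v n h) {j : ℕ} (hj : j ≤ n)
    (hv : flatHeight p q A j ≤ v) (hm : flatHeight p q A j ≤ m) : j ≤ h m :=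
  natCast_le_of_superharmonic hp hq hpq H.nonneg
    (fun x hx => H.laplacian_nonpos (hD x (Int.add_one_le_iff.mp hx))) hv
    (by rw [H.apply_source]; exact mod_cast hj) hm

lemma apply_eq_level (hp : 0 < p) (hq : 0 < q) (hpq : p.Coprime q)
    (hD : ∀ m : ℤ, A < m → m ∈ D) (H : IsWaveProfile (p : ℤ) q D v n h)
    (hv : flatHeight p q A n ≤ v) (hm : flatHeight p q A n ≤ m) : h m = n :=
  (H.le_level m).antisymm (H.natCast_le hp hq hpq hD le_rfl hv hm)

lemma le_max (hD : ∀ m ∈ D, -(A : ℤ) ≤ m) (H : IsWaveProfile (p : ℤ) q D v n h)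
    (hv : n ≤ v + (A + p + q)) (m : ℤ) : h m ≤ max (m + (A + p + q)) 0 := by
  let g (x : ℤ) : ℤ := max (x + (A + p + q)) 0
  have h_le_g : h ≤ g := by
    refine H.2 ⟨fun x => le_max_right _ _, le_max_of_le_left hv, fun w hw _ => ?_⟩
    have := hD w hw
    simp only [laplacian, g]
    omega
  exact h_le_g m

/- The minimum of the profile and of its translate, raised by a constant, is a supersolution. -/
lemma le_apply_sub_add (hD : ∀ m ∈ D, -(A : ℤ) ≤ m) (hD' : ∀ m : ℤ, A < m → m ∈ D)
    (H : IsWaveProfile (p : ℤ) q D v n h) (hv : n ≤ v + (A + p + q)) {t : ℤ} (ht : h (v - t) = n)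
    (m : ℤ) : h m ≤ h (m - t) + (2 * A + |t| + p + q) := by
  let g (x : ℤ) : ℤ := h (x - t) + (2 * A + |t| + p + q)
  have h_le_g : h ≤ h ⊓ g := by
    refine H.2 ⟨fun x => le_min (H.nonneg x) ?_, le_min H.apply_source.ge ?_, fun w hw _ => ?_⟩
    · exact add_nonneg (H.nonneg _) (by positivity)
    · simp only [g, ht]
      linarith [abs_nonneg t]
    · refine laplacian_inf_nonpos (fun _ => H.laplacian_nonpos hw) fun hlt => ?_
      have := H.le_max hD hv w
      have : 0 ≤ h (w - t) := H.nonneg _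
      have := H.laplacian_nonpos (hD' (w - t) (by
        simp only [g] at hlt
        have := le_abs_self t
        have := abs_nonneg t
        omega))
      simp only [laplacian, g, add_sub_right_comm, sub_right_comm] at this ⊢
      linarith
  exact (h_le_g m).trans (min_le_right _ _)

lemma isTame (hp : 0 < p) (hq : 0 < q) (hpq : p.Coprime q) (hD : ∀ m ∈ D, -(A : ℤ) ≤ m)
    (hD' : ∀ m : ℤ, A < m → m ∈ D) (H : IsWaveProfile (p : ℤ) q D v n h)
    (hv : flatHeight p q A n < v) : IsTame p q (2 * A + 1 + p + q) n h := by
  have le_v : n ≤ v + (A + p + q) := by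
    have : (n : ℤ) ≤ n * (p + q) := le_mul_of_one_le_right n.cast_nonneg (by omega)
    rw [flatHeight] at hv
    omega
  refine ⟨H.nonneg, fun m => ?_, fun m => ?_, fun m hm => H.laplacian_nonpos (hD' m ?_), ?_⟩
  · exact (H.le_max hD le_v m).trans (max_le_max_right 0 (by push_cast; omega))
  · have le_left := H.le_apply_sub_add hD hD' le_v (t := 1)
      (H.apply_eq_level hp hq hpq hD' hv.le (by omega)) (m + 1)
    have le_right := H.le_apply_sub_add hD hD' le_v (t := -1)
      (H.apply_eq_level hp hq hpq hD' hv.le (by omega)) m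
    rw [add_sub_cancel_right, abs_one] at le_left
    rw [sub_neg_eq_add, abs_neg, abs_one] at le_right
    rw [fwdDiff, abs_le]
    push_cast
    constructor <;> linarith
  · push_cast at hm
    omega
  · filter_upwards [Filter.eventually_ge_atTop (flatHeight p q A n)] with m hm
    exact H.apply_eq_level hp hq hpq hD' hv.le hm

end IsWaveProfile

lemma exists_isDefect_bound (hp : 0 < p) (hq : 0 < q) (hpq : p.Coprime q)
    (hD : ∀ m ∈ D, -(A : ℤ) ≤ m) (hD' : ∀ m : ℤ, A < m → m ∈ D) :
    ∃ (C : ℕ) (k : ℤ), ∀ n v h, flatHeight p q A n < v → IsWaveProfile (p : ℤ) q D v n h →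
      ∀ m : ℤ, IsDefect p q k n h m → m ≤ C ∨ |m + k - n| ≤ C := by
  obtain ⟨c, C, hC⟩ := IsTame.exists_abs_le_of_isDefect hp hq hpq (2 * A + 1 + p + q)
  -- Profiles of at least `N` waves dominate one that is maximal at `c`, so they share its offset.
  obtain ⟨_, ⟨N, v₀, h₀, hv₀, H₀, rfl⟩, le_h₀⟩ := Int.exists_greatest_of_bdd
    (P := fun z => ∃ n v h, flatHeight p q A n < v ∧ IsWaveProfile (p : ℤ) q D v n h ∧ h c = z)
    ⟨max (c + (2 * A + 1 + p + q : ℕ)) 0, by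
      rintro _ ⟨n, v, h, hv, H, rfl⟩
      exact (H.isTame hp hq hpq hD hD' hv).le_max c⟩
    ⟨0, 0, flatHeight p q A 0 + 1, 0, lt_add_one _, .zero, rfl⟩
  refine ⟨C + (flatHeight p q A N).toNat + p + q + N + (h₀ c - c).natAbs, h₀ c - c,
    fun n v h hv H m hm => or_iff_not_imp_left.mpr fun hCm => ?_⟩
  rcases le_or_gt N n with hNn | hNn
  · have hle : h₀ ≤ h := H₀.le_of_le_apply H
      (H.natCast_le hp hq hpq hD' hNn ((flatHeight_mono p q A hNn).trans hv.le) hv₀.le)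
    have hc : h₀ c = h c := (hle c).antisymm (le_h₀ _ ⟨n, v, h, hv, H, rfl⟩)
    rw [hc] at hm hCm ⊢
    exact (hC n h (H.isTame hp hq hpq hD hD' hv) m (by omega) hm).trans (by omega)
  · have := flatHeight_mono p q A hNn.le
    have := lt_of_isDefect_of_eq_const hm fun x hx =>
      H.apply_eq_level hp hq hpq hD' hv.le (by rw [abs_le] at hx; omega)
    omega

end LineProfile

/-! ### Waves on the cylinder -/

section Cylinder

variable {p q A n : ℕ} {D : Set (Cyl p q)} {S : Set (ℤ × ℤ)} {v w : Cyl p q}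
  {h : Cyl p q → ℕ} {φ : State p q}

/-- The height `pj - qi` of a site. For coprime `p` and `q` it identifies the cylinder with
`ℤ`. -/
def height (p q : ℕ) : Cyl p q →+ ℤ :=
  QuotientAddGroup.lift _ ((p : ℤ) • AddMonoidHom.snd ℤ ℤ - (q : ℤ) • AddMonoidHom.fst ℤ ℤ) <| by
    rw [AddSubgroup.zmultiples_le, AddMonoidHom.mem_ker]
    simp [mul_comm]

lemma height_site (p q : ℕ) (x : ℤ × ℤ) : height p q (site p q x) = p * x.2 - q * x.1 := by
  simp [height, site]

lemma height_stepX : height p q (stepX p q) = -q := by simp [stepX, height_site]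

lemma height_stepY : height p q (stepY p q) = p := by simp [stepY, height_site]

lemma height_injective (hp : 0 < p) (hpq : p.Coprime q) : Function.Injective (height p q) := by
  refine (injective_iff_map_eq_zero _).mpr fun w hw => ?_
  obtain ⟨x, rfl⟩ := QuotientAddGroup.mk_surjective w
  have hx : (p : ℤ) * x.2 - q * x.1 = 0 := (height_site p q x).symm.trans hw
  obtain ⟨c, hc⟩ : (p : ℤ) ∣ x.1 :=
    (Nat.isCoprime_iff_coprime.mpr hpq).dvd_of_dvd_mul_left ⟨x.2, by linarith⟩
  have hx₂ : x.2 = c * q := by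
    refine mul_left_cancel₀ (show (p : ℤ) ≠ 0 by omega) ?_
    rw [hc] at hx
    linarith
  rw [QuotientAddGroup.eq_zero_iff, AddSubgroup.mem_zmultiples_iff]
  exact ⟨c, Prod.ext (by simp [hc, mul_comm]) (by simp [hx₂])⟩

lemma height_surjective (hp : 0 < p) (hpq : p.Coprime q) : Function.Surjective (height p q) :=
  fun m => by
    obtain ⟨i, j, -, -, hij⟩ := exists_mul_sub_mul_eq hp hpq m
    exact ⟨site p q (i, j), (height_site p q _).trans hij⟩

lemma neg_le_height (hw : w ∈ internal p q S) : -((p * q : ℕ) : ℤ) ≤ height p q w := by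
  obtain ⟨⟨x, ⟨-, hx, hx'⟩, rfl⟩, -⟩ := hw
  rw [height_site]
  push_cast
  nlinarith

lemma mem_internal_of_lt_height (hp : 0 < p) (hpq : p.Coprime q)
    (hS : S ⊆ Set.Icc (0, 0) ((p : ℤ), (q : ℤ))) (hw : ((p * q : ℕ) : ℤ) < height p q w) :
    w ∈ internal p q S := by
  push_cast at hw
  refine ⟨?_, ?_⟩
  · obtain ⟨i, j, hi, hip, hij⟩ := exists_mul_sub_mul_eq hp hpq (height p q w)
    have hj : 0 ≤ j := by
      by_contra! hj
      nlinarith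
    exact ⟨(i, j), ⟨hi, hip.le, hj⟩, height_injective hp hpq (by rw [height_site, hij])⟩
  · rintro ⟨x, hx, rfl⟩
    obtain ⟨⟨hx₁ : 0 ≤ x.1, -⟩, -, hx₂ : x.2 ≤ q⟩ := hS hx
    rw [height_site] at hw
    nlinarith

lemma Waves.exists_line_profile (hp : 0 < p) (hpq : p.Coprime q) (hw : Waves D v n h φ) :
    ∃ H : ℤ → ℤ, (∀ w, (h w : ℤ) = H (height p q w)) ∧
      IsWaveProfile (p : ℤ) q (height p q '' D) (height p q v) n H ∧
      ∀ w ∈ D, φ w = 3 + laplacian (p : ℤ) q H (height p q w) := by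
  let e : Cyl p q ≃+ ℤ :=
    AddEquiv.ofBijective (height p q) ⟨height_injective hp hpq, height_surjective hp hpq⟩
  let H : ℤ → ℤ := (fun w => (h w : ℤ)) ∘ e.symm
  have apply_eq (w) : (h w : ℤ) = H (height p q w) :=
    congrArg (fun w => (h w : ℤ)) (e.symm_apply_apply w).symm
  have laplacian_eq (f : ℤ → ℤ) :
      laplacian (height p q (stepX p q)) (height p q (stepY p q)) f = laplacian (p : ℤ) q f := by
    rw [height_stepX, height_stepY, laplacian_neg_left, laplacian_comm]
  refine ⟨H, apply_eq, ?_, fun w hwD => ?_⟩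
  · have profile : IsWaveProfile (height p q (stepX p q)) (height p q (stepY p q))
      (height p q '' D) (height p q v) n H := hw.isWaveProfile.map e
    simpa only [IsWaveProfile, supersolutions, laplacian_eq] using profile
  · rw [hw.apply_eq hwD, funext apply_eq, ← laplacian_eq, ← laplacian_comp]
    rfl

lemma inTerritory_of_adj (hv : v ∈ D ∧ φ v = 3) (hw : w ∈ D ∧ φ w = 3)
    (hvw : (cylGraph p q).Adj v w) : InTerritory D φ v := by
  refine ⟨SimpleGraph.connectedComponentMk _ ⟨v, hv⟩, ⟨⟨v, hv⟩, rfl, ⟨w, hw⟩, ?_, ?_⟩, hv, rfl⟩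
  · rw [SimpleGraph.ConnectedComponent.mem_supp_iff, SimpleGraph.ConnectedComponent.eq]
    exact SimpleGraph.Adj.reachable hvw.symm
  · exact fun heq => hvw.ne (congrArg Subtype.val heq)

lemma adj_add_stepY (hp : 0 < p) (v : Cyl p q) : (cylGraph p q).Adj v (v + stepY p q) := by
  rw [cylGraph, SimpleGraph.fromRel_adj]
  refine ⟨fun heq => ?_, .inl (.inr rfl)⟩
  have := congrArg (height p q) heq
  rw [map_add, height_stepY] at this
  omega

lemma Waves.eq_three_of_flatHeight_le (hp : 0 < p) (hq : 0 < q) (hpq : p.Coprime q)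
    (hD : ∀ w, (A : ℤ) < height p q w → w ∈ D) (hw : Waves D v n h φ)
    (hv : flatHeight p q A n ≤ height p q v) (hle : flatHeight p q A (n + 1) ≤ height p q w) :
    w ∈ D ∧ φ w = 3 := by
  obtain ⟨H, -, profile, φ_eq⟩ := hw.exists_line_profile hp hpq
  have flat {m : ℤ} (hm : flatHeight p q A n ≤ m) : H m = n :=
    profile.apply_eq_level hp hq hpq (fun m hm => by
      obtain ⟨w, rfl⟩ := height_surjective hp hpq m
      exact ⟨w, hD w hm, rfl⟩) hv hm
  have flat_le : flatHeight p q A n + (p + q) ≤ height p q w := by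
    rw [flatHeight] at hle ⊢
    push_cast at hle
    linarith
  have hwD : w ∈ D := hD w (by
    have : (0 : ℤ) ≤ n * (p + q) := by positivity
    rw [flatHeight] at flat_le
    omega)
  refine ⟨hwD, ?_⟩
  rw [φ_eq w hwD, laplacian, flat (by omega), flat (by omega), flat (by omega), flat (by omega),
    flat (by omega)]
  ring

lemma exists_waves (hp : 0 < p) (hq : 0 < q) (hpq : p.Coprime q)
    (hD : ∀ w, (A : ℤ) < height p q w → w ∈ D) (hv : flatHeight p q A n ≤ height p q v) :
    ∃ h φ, Waves D v n h φ := by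
  induction n with
  | zero => exact ⟨_, _, rfl, rfl⟩
  | succ n ih =>
    have hvn := (flatHeight_mono p q A n.le_succ).trans hv
    obtain ⟨h, φ, hw⟩ := ih hvn
    refine hw.exists_succ (inTerritory_of_adj (hw.eq_three_of_flatHeight_le hp hq hpq hD hvn hv)
      (hw.eq_three_of_flatHeight_le hp hq hpq hD hvn ?_) (adj_add_stepY hp v))
    rw [map_add, height_stepY]
    omega

/-- All defects and coloured sites of `n` waves sent from a sufficiently high site have a height
that is at most `C` or differs from `n - k` by at most `C`. -/
def ConfinesDefects (D : Set (Cyl p q)) (A : ℕ) (k : ℤ) (C : ℕ) : Prop :=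
  ∀ n v h φ, flatHeight p q A n < height p q v → Waves D v n h φ →
    ∀ w, ((h w : ℤ) ≠ min (height p q w + k) n ∨ w ∈ D ∧ φ w < 3) →
      height p q w ≤ C ∨ |height p q w + k - n| ≤ C

lemma ConfinesDefects.mono {k : ℤ} {C C' : ℕ} (hC : ConfinesDefects D A k C) (hle_C : C ≤ C') :
    ConfinesDefects D A k C' := fun n v h φ hv hw w hdef =>
  (hC n v h φ hv hw w hdef).imp (fun hle => by omega) fun hle => by omega

lemma exists_confinesDefects (hp : 0 < p) (hq : 0 < q) (hpq : p.Coprime q)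
    (hD : ∀ w ∈ D, -(A : ℤ) ≤ height p q w) (hD' : ∀ w, (A : ℤ) < height p q w → w ∈ D) :
    ∃ C k, ConfinesDefects D A k C := by
  obtain ⟨C, k, hC⟩ := exists_isDefect_bound (D := height p q '' D) hp hq hpq
    (Set.forall_mem_image.mpr hD) fun m hm => by
      obtain ⟨w, rfl⟩ := height_surjective hp hpq m
      exact ⟨w, hD' w hm, rfl⟩
  refine ⟨C, k, fun n v h φ hv hw w hdef => ?_⟩
  obtain ⟨H, h_eq, profile, φ_eq⟩ := hw.exists_line_profile hp hpq
  refine hC n _ H hv profile _ (hdef.imp (fun hne => h_eq w ▸ hne) fun ⟨hwD, hlt⟩ => ?_)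
  rw [φ_eq w hwD] at hlt
  omega

lemma exists_confinesDefects_internal (hp : 0 < p) (hq : 0 < q) (hpq : p.Coprime q) :
    ∃ C, ∀ S ⊆ Set.Icc (0, 0) ((p : ℤ), (q : ℤ)),
      ∃ k, ConfinesDefects (internal p q S) (p * q) k C := by
  have hfin : {S | S ⊆ Set.Icc (0, 0) ((p : ℤ), (q : ℤ))}.Finite :=
    (Set.finite_Icc _ _).finite_subsets
  refine ((Filter.eventually_all_finite (l := Filter.atTop) hfin).mpr fun S hS => ?_).exists
  obtain ⟨C, k, hC⟩ := exists_confinesDefects (D := internal p q S) hp hq hpq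
    (fun w hw => neg_le_height hw) fun w hw => mem_internal_of_lt_height hp hpq hS hw
  filter_upwards [Filter.eventually_ge_atTop C] with C' hle_C
  exact ⟨k, hC.mono hle_C⟩

/-- The union of the box of height `C` at the boundary and of the neighbourhood of width `C` of
the line `pj - qi + k = n`, the latter cut off at the heights `a` and `a + C`. -/
def defectRegion (p q : ℕ) (a k : ℤ) (n C : ℕ) : Set (ℤ × ℤ) :=
  box p 0 C ∪ box p a (a + C) ∩ band p q k n C

lemma defectRegion_mono (p q : ℕ) (a k : ℤ) (n : ℕ) : Monotone (defectRegion p q a k n) := by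
  intro C C' hle_C
  refine Set.union_subset_union ?_ (Set.inter_subset_inter ?_ fun x hx => ?_)
  · exact Set.Icc_subset_Icc_right ⟨le_rfl, by simpa using hle_C⟩
  · exact Set.Icc_subset_Icc_right ⟨le_rfl, by simpa using hle_C⟩
  · exact le_trans (b := (C : ℤ)) hx (mod_cast hle_C)

lemma encard_box (p : ℕ) (a : ℤ) (C : ℕ) :
    (box p a (a + C)).encard = ((p + 1) * (C + 1) : ℕ) := by
  have box_eq : box p a (a + C) = (Finset.Icc (0, a) ((p : ℤ), a + C) : Finset (ℤ × ℤ)) :=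
    (Finset.coe_Icc _ _).symm
  rw [box_eq, Set.encard_coe_eq_coe_finsetCard, Finset.card_Icc_prod, Int.card_Icc, Int.card_Icc]
  congr 2
  omega

lemma encard_defectRegion_lt (p q : ℕ) (a k : ℤ) (n C : ℕ) :
    (defectRegion p q a k n C).encard < (2 * ((p + 1) * (C + 1)) + 1 : ℕ) :=
  calc (defectRegion p q a k n C).encard
      ≤ (box p 0 (0 + C)).encard + (box p a (a + C)).encard := by
        rw [zero_add]
        exact (Set.encard_union_le _ _).trans
          (add_le_add_right (Set.encard_le_encard Set.inter_subset_left) _)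
    _ = (2 * ((p + 1) * (C + 1)) : ℕ) := by rw [encard_box, encard_box, two_mul, Nat.cast_add]
    _ < (2 * ((p + 1) * (C + 1)) + 1 : ℕ) := Nat.cast_lt.mpr (Nat.lt_succ_self _)

lemma mem_defectRegion (hp : 0 < p) {x : ℤ × ℤ} (hx : x ∈ strip p) {C : ℕ} {k : ℤ}
    (h : p * x.2 - q * x.1 ≤ C ∨ |p * x.2 - q * x.1 + k - n| ≤ C) :
    x ∈ defectRegion p q ((n - k - C) / p) k n (2 * C + p * q + 1) := by
  obtain ⟨hx₀, hxp, hx₂⟩ := hx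
  have qx_nonneg : 0 ≤ q * x.1 := by positivity
  have qx_le : q * x.1 ≤ p * q := by nlinarith
  have le_px : x.2 ≤ p * x.2 := le_mul_of_one_le_left hx₂ (mod_cast hp)
  rcases h with hle | hle
  · refine .inl ⟨⟨hx₀, hx₂⟩, hxp, ?_⟩
    push_cast
    linarith
  · refine .inr ⟨⟨⟨hx₀, ?_⟩, hxp, ?_⟩, hle.trans (by push_cast; omega)⟩ <;> rw [abs_le] at hle
    · exact Int.ediv_le_of_le_mul (by omega) (by linarith)
    · have := Int.lt_ediv_add_one_mul_self (n - k - C) (show (0 : ℤ) < p by omega)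
      push_cast
      by_contra! hlt
      nlinarith

lemma ConfinesDefects.subset_defectRegion (hp : 0 < p) {k : ℤ} {C : ℕ}
    (hC : ConfinesDefects D A k C) (hv : flatHeight p q A n < height p q v)
    (hw : Waves D v n h φ) :
    defectSet p q h k n ∪ coloredSet p q D φ ⊆
      defectRegion p q ((n - k - C) / p) k n (2 * C + p * q + 1) := by
  intro x hx
  have hconf := hC n v h φ hv hw (site p q x)
  rw [height_site] at hconf
  rcases hx with ⟨hx, hne⟩ | ⟨hx, hcol⟩
  · exact mem_defectRegion hp hx (hconf (.inl hne))
  · exact mem_defectRegion hp hx (hconf (.inr hcol))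

lemma lt_height_site (hp : 0 < p) {B i N : ℤ} (hB : 0 ≤ B) (hi : i ≤ p)
    (hN : B + 1 + q * p ≤ N) : B < height p q (site p q (i, N)) := by
  rw [height_site]
  have : (q : ℤ) * i ≤ q * p := by gcongr
  have : N ≤ p * N := le_mul_of_one_le_left (by nlinarith) (mod_cast hp)
  simp only
  linarith

end Cylinder

end WaveCylinder

open WaveCylinder

theorem mainTheorem6 (p q : ℕ) (hp : 0 < p) (hq : 0 < q) (hpq : Nat.Coprime p q) :
    ∃ C : ℕ, ∀ S : Set (ℤ × ℤ), S ⊆ Set.Icc (0, 0) ((p : ℤ), (q : ℤ)) →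
      ∃ k : ℤ, ∀ n : ℕ, ∃ N₀ : ℤ, ∀ i₀ N : ℤ, 0 ≤ i₀ → i₀ ≤ p → N₀ ≤ N →
        (∃ (h : WaveCylinder.Cyl p q → ℕ) (φ : WaveCylinder.State p q),
          WaveCylinder.Waves (WaveCylinder.internal p q S) (WaveCylinder.site p q (i₀, N))
            n h φ) ∧
        ∀ (h : WaveCylinder.Cyl p q → ℕ) (φ : WaveCylinder.State p q),
          WaveCylinder.Waves (WaveCylinder.internal p q S) (WaveCylinder.site p q (i₀, N))
            n h φ →
          (WaveCylinder.defectSet p q h k n).encard < C ∧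
          ∃ (a : ℤ) (B E : Set (ℤ × ℤ)),
            WaveCylinder.defectSet p q h k n = B ∪ E ∧
            B ⊆ WaveCylinder.box p 0 C ∧
            E ⊆ WaveCylinder.box p a (a + C) ∩ WaveCylinder.band p q k n C ∧
            WaveCylinder.coloredSet p q (WaveCylinder.internal p q S) φ ⊆
              WaveCylinder.box p 0 C ∪
                (WaveCylinder.box p a (a + C) ∩ WaveCylinder.band p q k n C) := by
  obtain ⟨C, hC⟩ := exists_confinesDefects_internal hp hq hpq
  let C₁ : ℕ := 2 * C + p * q + 1
  let C₂ : ℕ := 2 * ((p + 1) * (C₁ + 1)) + 1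
  refine ⟨C₂, fun S hS => ?_⟩
  obtain ⟨k, hk⟩ := hC S hS
  refine ⟨k, fun n => ⟨flatHeight p q (p * q) n + 1 + q * p, fun i₀ N _ hi₀ hN => ?_⟩⟩
  have hv : flatHeight p q (p * q) n < height p q (site p q (i₀, N)) :=
    lt_height_site hp (by unfold flatHeight; positivity) hi₀ hN
  refine ⟨exists_waves hp hq hpq (fun w hw => mem_internal_of_lt_height hp hpq hS hw) hv.le,
    fun h φ hw => ?_⟩
  set a : ℤ := (n - k - C) / p
  obtain ⟨defects_subset, colored_subset⟩ := Set.union_subset_iff.mp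
    (hk.subset_defectRegion hp hv hw)
  have region_subset : defectRegion p q a k n C₁ ⊆ defectRegion p q a k n C₂ :=
    defectRegion_mono p q a k n (by dsimp only [C₂]; nlinarith)
  refine ⟨?_, a, defectSet p q h k n ∩ box p 0 C₂,
    defectSet p q h k n ∩ (box p a (a + C₂) ∩ band p q k n C₂), ?_, Set.inter_subset_right,
    Set.inter_subset_right, colored_subset.trans region_subset⟩
  · exact (Set.encard_le_encard defects_subset).trans_lt (encard_defectRegion_lt p q a k n C₁)
  · rw [← Set.inter_union_distrib_left]
    exact (Set.inter_eq_left.mpr (defects_subset.trans region_subset)).symm
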